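/- Let $n\ge 1$ be an integer and let $\mathbb{Z}_n=\mathbb{Z}/n\mathbb{Z}$. Put $Q_n=\{r^2 : r\in\mathbb{Z}_n^*\}$ and $V_n=Q_n\cup(-Q_n)$. The quadratic unitary Cayley graph $\mathcal{G}_{\mathbb{Z}_n}$ is the simple graph with vertex set $\mathbb{Z}_n$ in which two distinct vertices $u,v$ are adjacent if and only if $u-v\in V_n$. For a finite simple graph $G$, let $\mathcal{A}(G)$ be the set of arcs of $G$, i.e. ordered pairs $a=(u,v)$ of adjacent vertices, with terminus $t(a)=v$ and inverse $a^{-1}=(v,u)$. Let $N\in\mathbb{C}^{V(G)\times\mathcal{A}(G)}$ be given by $N_{xa}=\frac{1}{\sqrt{\deg x}}\,\delta_{x,t(a)}$, let $C=2N^*N-I$, let $R_{ab}=\delta_{a,b^{-1}}$, and let $U=RC$ be the time evolution matrix of the Grover walk on $G$. A state is a vector $\Phi\in\mathbb{C}^{\mathcal{A}(G)}$ with $\langle\Phi,\Phi\rangle=1$. Perfect state transfer occurs from a state $\Phi$ to another state $\Psi\neq\Phi$ at time $\tau\in\mathbb{N}$ if $U^\tau\Phi=\gamma\Psi$ for some $\gamma\in\mathbb{C}$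 with $|\gamma|=1$. Perfect state transfer occurs from a vertex $u$ to a vertex $v$ at time $\tau$ if it occurs from $N^*\mathbf{e}_u$ to $N^*\mathbf{e}_v$ at time $\tau$, where $\mathbf{e}_u$ is the standard unit vector at $u$ and both vectors are states. $G$ exhibits perfect state transfer if it occurs from some vertex to some vertex at some time. Then $\mathcal{G}_{\mathbb{Z}_n}$ exhibits perfect state transfer if and only if $n\in\{2,4,6,8,12,24,10,20\}$; equivalently, if and only if $n=2^\alpha3^\beta$ for some integers $1\le\alpha\le3$ and $0\le\beta\le1$, or $n=10$, or $n=20$. Moreover, whenever perfect state transfer occurs from a vertex $u$ to a vertex $v$ of $\mathcal{G}_{\mathbb{Z}_{20}}$, the least time at which it occurs is $10$. -/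

import Mathlib

open scoped Matrix

namespace GroverWalk

noncomputable section

section Graph

variable {V : Type*} [Fintype V] [DecidableEq V] (G : SimpleGraph V) [DecidableRel G.Adj]

/-- The boundary matrix `N`: `N x a = 1 / √(deg x)` if `x` is the terminus of the arc `a`, and `0`
otherwise. The arcs of `G` are its darts; the dart `a` has origin `a.fst` and terminus `a.snd`. -/
def boundaryMatrix : Matrix V G.Dart ℂ :=
  Matrix.of fun x a => if x = a.snd then ((1 / Real.sqrt (G.degree x) : ℝ) : ℂ) else 0

/-- The coin matrix `C = 2 N⋆ N - I`. -/
def coinMatrix : Matrix G.Dart G.Dart ℂ :=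
  (2 : ℂ) • ((boundaryMatrix G)ᴴ * boundaryMatrix G) - 1

/-- The shift matrix `R`: `R a b = 1` if `a` is the inverse arc of `b`, and `0` otherwise. -/
def shiftMatrix : Matrix G.Dart G.Dart ℂ :=
  Matrix.of fun a b => if a = b.symm then 1 else 0

/-- The time evolution matrix `U = R C` of the Grover walk on `G`. -/
def timeEvolution : Matrix G.Dart G.Dart ℂ :=
  shiftMatrix G * coinMatrix G

variable {G} in
/-- A state is a unit vector of `ℂ^𝒜(G)`. -/
def IsState (Φ : G.Dart → ℂ) : Prop :=
  star Φ ⬝ᵥ Φ = 1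

variable {G} in
/-- Perfect state transfer from the state `Φ` to another state `Ψ` at time `τ`. -/
def StateTransferAt (Φ Ψ : G.Dart → ℂ) (τ : ℕ) : Prop :=
  IsState Φ ∧ IsState Ψ ∧ Φ ≠ Ψ ∧ ∃ γ : ℂ, ‖γ‖ = 1 ∧ (timeEvolution G ^ τ) *ᵥ Φ = γ • Ψ

/-- The vector `N⋆ e_u` of vertex type. -/
def vertexState (u : V) : G.Dart → ℂ :=
  (boundaryMatrix G)ᴴ *ᵥ Pi.single u 1

/-- Perfect state transfer from the vertex `u` to the vertex `v` at time `τ`. -/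
def TransferAt (u v : V) (τ : ℕ) : Prop :=
  StateTransferAt (vertexState G u) (vertexState G v) τ

/-- `G` exhibits perfect state transfer (between vertex-type states). -/
def ExhibitsTransfer : Prop :=
  ∃ u v : V, ∃ τ : ℕ, TransferAt G u v τ

end Graph

end

/-- `Q_n`, the set of squares of units of `ℤ/nℤ`. -/
def unitSquares (n : ℕ) : Set (ZMod n) :=
  {x | ∃ r : (ZMod n)ˣ, x = (r : ZMod n) ^ 2}

/-- `V_n = Q_n ∪ (-Q_n)`. -/
def connectionSet (n : ℕ) : Set (ZMod n) :=
  {x | x ∈ unitSquares n ∨ -x ∈ unitSquares n}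

instance (n : ℕ) [NeZero n] : DecidablePred (· ∈ unitSquares n) := fun x =>
  inferInstanceAs (Decidable (∃ r : (ZMod n)ˣ, x = (r : ZMod n) ^ 2))

instance (n : ℕ) [NeZero n] : DecidablePred (· ∈ connectionSet n) := fun x =>
  inferInstanceAs (Decidable (x ∈ unitSquares n ∨ -x ∈ unitSquares n))

/-- The quadratic unitary Cayley graph `Cay(ℤ/nℤ, V_n)`. -/
def quadraticUnitaryCayleyGraph (n : ℕ) : SimpleGraph (ZMod n) :=
  SimpleGraph.circulantGraph (connectionSet n)

instance (n : ℕ) [NeZero n] : DecidableRel (quadraticUnitaryCayleyGraph n).Adj :=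
  inferInstanceAs (DecidableRel (SimpleGraph.circulantGraph (connectionSet n)).Adj)

end GroverWalk

namespace GroverWalk

/-! ### Grover walk on a general graph and its Chebyshev compression. -/

section Graph

/-! The compression of `U ^ τ` to vertex-type vectors is the Chebyshev polynomial `T_τ` of the
discriminant, the random-walk matrix on a regular graph (`vecMul_vertexEvolution`). Characters of
`ℤ/nℤ` diagonalise it with real eigenvalues `λ_k`, so transfer from `u` to `v` means `T_τ(λ_k) =
χ(k(v - u))` for all `k`. As `λ_{-k} = λ_k`, the difference `v - u` has order two, and the condition
becomes `T_τ(λ_k) = (-1)^k` with `n` even.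

For necessity, each divisor `m` of `n` contributes its eigenvalues (`walkEigenvalue_div_mul`), and
`T_τ(λ) = ±1` makes `2λ` an algebraic integer. Vanishing eigenvalues exclude odd squares and 16;
integrality excludes primes above 5 (the eigenvalues of a residue and a nonresidue have a rational
sum) and the divisors 15 and 40 (through `cos (π / 5)`). Hence `n ∣ 120`, which leaves the list.

For sufficiency, every listed `n` except 20 has all unit squares equal to `±1`, so `λ_k = cos (2πk /
n)` and `τ = n / 2` works. For `n = 20`, `λ_k` is a product of two cosines and `τ = 10` works; `λ_1`
and `λ_4` force `τ ≡ 2` mod 4 and `5 ∣ τ`. -/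

theorem conjTranspose_shiftMatrix {V : Type*} [DecidableEq V] (G : SimpleGraph V) :
    (shiftMatrix G)ᴴ = shiftMatrix G := by
  ext a b
  simp only [Matrix.conjTranspose_apply, shiftMatrix, Matrix.of_apply]
  have : b = a.symm ↔ a = b.symm := by
    constructor <;> rintro rfl <;> simp
  simp [this, apply_ite]

variable {V : Type*} [Fintype V] [DecidableEq V] (G : SimpleGraph V) [DecidableRel G.Adj]

theorem sum_darts_fst_eq {M : Type*} [AddCommMonoid M] (v : V) (f : V → M) :
    ∑ a : G.Dart, (if v = a.fst then f a.snd else 0) = ∑ w ∈ G.neighborFinset v, f w := by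
  rw [← Finset.sum_filter]
  symm
  refine Finset.sum_bij' (fun w hw => ⟨(v, w), by simpa using hw⟩) (fun a _ => a.snd) ?_ ?_ ?_ ?_ ?_
  · intro w hw; simp
  · intro a ha
    obtain rfl : v = a.fst := by simpa using ha
    simp [a.adj]
  · intro w hw; rfl
  · intro a ha
    obtain rfl : v = a.fst := by simpa using ha
    rfl
  · intro w hw; rfl

theorem sum_darts_snd_eq {M : Type*} [AddCommMonoid M] (v : V) (f : V → M) :
    ∑ a : G.Dart, (if v = a.snd then f a.fst else 0) = ∑ w ∈ G.neighborFinset v, f w := by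
  rw [← sum_darts_fst_eq]
  exact Fintype.sum_equiv (Equiv.ofBijective _ (SimpleGraph.Dart.symm_involutive).bijective) _ _
    fun a => rfl

/-- Distinct rows have disjoint supports, and row `u` has `deg u` nonzero entries `1 / √(deg u)`.
Thus `N⋆` is an isometry. -/
theorem boundaryMatrix_mul_conjTranspose (h : ∀ v, 0 < G.degree v) :
    boundaryMatrix G * (boundaryMatrix G)ᴴ = 1 := by
  ext u v
  rw [Matrix.mul_apply, Matrix.one_apply]
  simp only [Matrix.conjTranspose_apply, boundaryMatrix, Matrix.of_apply]
  split_ifs with huv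
  · subst huv
    have hu : (0 : ℝ) < G.degree u := by exact_mod_cast h u
    have : ∀ a : G.Dart, (if u = a.snd then ((1 / Real.sqrt (G.degree u) : ℝ) : ℂ) else 0) *
        star (if u = a.snd then ((1 / Real.sqrt (G.degree u) : ℝ) : ℂ) else 0) =
        if u = a.snd then (fun _ => ((1 / (G.degree u) : ℝ) : ℂ)) a.fst else 0 := by
      intro a
      split_ifs
      · rw [Complex.star_def, Complex.conj_ofReal, ← Complex.ofReal_mul, div_mul_div_comm,
          Real.mul_self_sqrt hu.le, one_mul]
      · simp
    rw [Finset.sum_congr rfl fun a _ => this a,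
      sum_darts_snd_eq G u (fun _ => ((1 / (G.degree u) : ℝ) : ℂ))]
    have hu' : (G.degree u : ℂ) ≠ 0 := by exact_mod_cast (h u).ne'
    simp [hu']
  · refine Finset.sum_eq_zero fun a _ => ?_
    split_ifs with h1 h2 <;> simp_all

theorem shiftMatrix_mul_self : shiftMatrix G * shiftMatrix G = 1 := by
  ext a b
  simp [Matrix.mul_apply, shiftMatrix, Matrix.one_apply]

theorem conjTranspose_coinMatrix : (coinMatrix G)ᴴ = coinMatrix G := by
  simp [coinMatrix, Matrix.conjTranspose_sub, Matrix.conjTranspose_smul]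

theorem coinMatrix_mul_self (h : ∀ v, 0 < G.degree v) : coinMatrix G * coinMatrix G = 1 := by
  have hN := boundaryMatrix_mul_conjTranspose G h
  have hP : (boundaryMatrix G)ᴴ * boundaryMatrix G * ((boundaryMatrix G)ᴴ * boundaryMatrix G) =
      (boundaryMatrix G)ᴴ * boundaryMatrix G := by
    rw [Matrix.mul_assoc, ← Matrix.mul_assoc (boundaryMatrix G), hN, Matrix.one_mul]
  rw [coinMatrix, sub_mul, mul_sub, one_mul, mul_one, Matrix.smul_mul, Matrix.mul_smul, hP]
  module

theorem conjTranspose_timeEvolution_mul (h : ∀ v, 0 < G.degree v) :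
    (timeEvolution G)ᴴ * timeEvolution G = 1 := by
  rw [timeEvolution, Matrix.conjTranspose_mul, conjTranspose_shiftMatrix, conjTranspose_coinMatrix,
    Matrix.mul_assoc, ← Matrix.mul_assoc (shiftMatrix G), shiftMatrix_mul_self, Matrix.one_mul,
    coinMatrix_mul_self G h]

theorem conjTranspose_timeEvolution_pow_mul (h : ∀ v, 0 < G.degree v) (τ : ℕ) :
    (timeEvolution G ^ τ)ᴴ * timeEvolution G ^ τ = 1 := by
  have hU : timeEvolution G ∈ unitary (Matrix G.Dart G.Dart ℂ) := by
    rw [Unitary.mem_iff]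
    have := conjTranspose_timeEvolution_mul G h
    exact ⟨this, mul_eq_one_comm.mp this⟩
  exact (Unitary.mem_iff.mp (pow_mem hU τ)).1

/-- The discriminant of the walk; for a regular graph, the transition matrix of the simple
random walk. -/
noncomputable def discriminant : Matrix V V ℂ :=
  boundaryMatrix G * shiftMatrix G * (boundaryMatrix G)ᴴ

/-- The compression of the `τ`-th power of the time evolution to vertex-type vectors. -/
noncomputable def vertexEvolution (τ : ℕ) : Matrix V V ℂ :=
  boundaryMatrix G * timeEvolution G ^ τ * (boundaryMatrix G)ᴴ

/-- The coin is the reflection fixing the range of `N⋆`. -/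
theorem timeEvolution_mul_conjTranspose_boundaryMatrix (h : ∀ v, 0 < G.degree v) :
    timeEvolution G * (boundaryMatrix G)ᴴ = shiftMatrix G * (boundaryMatrix G)ᴴ := by
  rw [timeEvolution, coinMatrix, Matrix.mul_assoc, Matrix.sub_mul, Matrix.smul_mul, Matrix.mul_assoc,
    boundaryMatrix_mul_conjTranspose G h, Matrix.mul_one, Matrix.one_mul]
  congr 1
  module

/-- The ranges of `N⋆` and `R N⋆` together span a `U`-invariant space. Multiplying on the left by `N
U ^ τ` gives the three-term Chebyshev recurrence. -/
theorem timeEvolution_sq_mul_conjTranspose_boundaryMatrix (h : ∀ v, 0 < G.degree v) :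
    timeEvolution G * (timeEvolution G * (boundaryMatrix G)ᴴ) =
      (2 : ℂ) • (timeEvolution G * (boundaryMatrix G)ᴴ * discriminant G) - (boundaryMatrix G)ᴴ := by
  rw [timeEvolution_mul_conjTranspose_boundaryMatrix G h, discriminant, timeEvolution, coinMatrix,
    Matrix.mul_assoc, Matrix.sub_mul, Matrix.smul_mul, Matrix.mul_sub, Matrix.mul_smul, Matrix.one_mul,
    ← Matrix.mul_assoc (shiftMatrix G) (shiftMatrix G), shiftMatrix_mul_self, Matrix.one_mul]
  simp only [Matrix.mul_assoc]

theorem vertexEvolution_add_two (h : ∀ v, 0 < G.degree v) (τ : ℕ) :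
    vertexEvolution G (τ + 2) =
      (2 : ℂ) • (vertexEvolution G (τ + 1) * discriminant G) - vertexEvolution G τ := by
  have := timeEvolution_sq_mul_conjTranspose_boundaryMatrix G h
  simp only [vertexEvolution, pow_succ, Matrix.mul_assoc] at this ⊢
  rw [this]
  simp only [Matrix.mul_sub, Matrix.mul_smul]

/-- Left eigenvectors of the discriminant are left eigenvectors of the compressed evolution, and
the eigenvalues are given by the Chebyshev polynomials of the first kind. -/
theorem vecMul_vertexEvolution (h : ∀ v, 0 < G.degree v) {f : V → ℂ} {μ : ℂ}
    (hf : f ᵥ* discriminant G = μ • f) (τ : ℕ) :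
    f ᵥ* vertexEvolution G τ = (Polynomial.Chebyshev.T ℂ τ).eval μ • f := by
  induction τ using Nat.twoStepInduction with
  | zero => simp [vertexEvolution, boundaryMatrix_mul_conjTranspose G h]
  | one =>
    rw [vertexEvolution, pow_one, Matrix.mul_assoc,
      timeEvolution_mul_conjTranspose_boundaryMatrix G h, ← Matrix.mul_assoc]
    simpa [discriminant] using hf
  | more τ ih₀ ih₁ =>
    rw [vertexEvolution_add_two G h, Matrix.vecMul_sub, Matrix.vecMul_smul, ← Matrix.vecMul_vecMul,
      ih₁, Matrix.smul_vecMul, hf, ih₀]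
    push_cast
    rw [Polynomial.Chebyshev.T_add_two]
    ext x
    simp
    ring

theorem vecMul_discriminant_apply {d : ℕ} (hd : G.IsRegularOfDegree d) (f : V → ℂ) (v : V) :
    (f ᵥ* discriminant G) v = (∑ w ∈ G.neighborFinset v, f w) / d := by
  have h1 : f ᵥ* boundaryMatrix G = fun a => f a.snd * ((1 / Real.sqrt d : ℝ) : ℂ) := by
    ext a
    simp [Matrix.vecMul, dotProduct, boundaryMatrix, hd.degree_eq]
  have h2 : (fun a : G.Dart => f a.snd * ((1 / Real.sqrt d : ℝ) : ℂ)) ᵥ* shiftMatrix G =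
      fun a => f a.fst * ((1 / Real.sqrt d : ℝ) : ℂ) := by
    ext a
    simp [Matrix.vecMul, dotProduct, shiftMatrix]
  rw [discriminant, ← Matrix.vecMul_vecMul, ← Matrix.vecMul_vecMul, h1, h2, ← sum_darts_snd_eq,
    Finset.sum_div]
  simp only [Matrix.vecMul, dotProduct, Matrix.conjTranspose_apply, boundaryMatrix, Matrix.of_apply]
  refine Finset.sum_congr rfl fun a _ => ?_
  split_ifs
  · rw [Complex.star_def, Complex.conj_ofReal, mul_assoc, ← Complex.ofReal_mul, hd.degree_eq,
      div_mul_div_comm, Real.mul_self_sqrt (Nat.cast_nonneg d)]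
    simp [div_eq_mul_inv]
  · simp

theorem star_dotProduct_vertexState (M : Matrix G.Dart G.Dart ℂ)
    (u v : V) :
    star (vertexState G v) ⬝ᵥ (M *ᵥ vertexState G u) =
      (boundaryMatrix G * M * (boundaryMatrix G)ᴴ) v u := by
  have hs : star (vertexState G v) = Pi.single v 1 ᵥ* boundaryMatrix G := by
    rw [vertexState, Matrix.star_mulVec, Matrix.conjTranspose_conjTranspose]
    congr 1
    ext x
    simp [Pi.single_apply, apply_ite]
  rw [hs, vertexState, Matrix.mulVec_mulVec, Matrix.dotProduct_mulVec, Matrix.vecMul_vecMul,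
    ← Matrix.mul_assoc]
  simp

theorem isState_vertexState (h : ∀ v, 0 < G.degree v) (u : V) : IsState (vertexState G u) := by
  have := star_dotProduct_vertexState G 1 u u
  rwa [Matrix.one_mulVec, Matrix.mul_one, boundaryMatrix_mul_conjTranspose G h,
    Matrix.one_apply_eq] at this

theorem boundaryMatrix_mulVec_vertexState (h : ∀ v, 0 < G.degree v) (u : V) :
    boundaryMatrix G *ᵥ vertexState G u = Pi.single u 1 := by
  rw [vertexState, Matrix.mulVec_mulVec, boundaryMatrix_mul_conjTranspose G h, Matrix.one_mulVec]

theorem vertexState_injective (h : ∀ v, 0 < G.degree v) : Function.Injective (vertexState G) := by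
  intro u v huv
  have := congrArg (boundaryMatrix G *ᵥ ·) huv
  simp only [boundaryMatrix_mulVec_vertexState G h] at this
  by_contra hne
  simpa [Pi.single_apply, hne] using congrFun this u

theorem TransferAt.ne {u v : V} {τ : ℕ} (ht : TransferAt G u v τ) : u ≠ v := fun h =>
  ht.2.2.1 (congrArg _ h)

/-- Apply `N` to the transfer equation and pair with a left eigenvector. One phase `γ` serves all
eigenvectors at once. -/
theorem TransferAt.exists_eval_mul_eq (h : ∀ v, 0 < G.degree v) {u v : V} {τ : ℕ}
    (ht : TransferAt G u v τ) :
    ∃ γ : ℂ, ∀ (f : V → ℂ) (μ : ℂ), f ᵥ* discriminant G = μ • f →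
      (Polynomial.Chebyshev.T ℂ τ).eval μ * f u = γ * f v := by
  obtain ⟨-, -, -, γ, -, hγ⟩ := ht
  refine ⟨γ, fun f μ hf => ?_⟩
  have h1 : vertexEvolution G τ *ᵥ Pi.single u 1 = γ • Pi.single v 1 := by
    rw [← boundaryMatrix_mulVec_vertexState G h v, ← Matrix.mulVec_smul, ← hγ, vertexEvolution,
      vertexState, Matrix.mulVec_mulVec, Matrix.mulVec_mulVec, Matrix.mul_assoc]
  have h2 := congrArg (f ⬝ᵥ ·) h1
  simp only [Matrix.dotProduct_mulVec, vecMul_vertexEvolution G h hf] at h2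
  simpa using h2

open ComplexOrder in
-- Equality case of Cauchy–Schwarz: the squared norm of `x - y` is `1 - 1 - 1 + 1`.
theorem eq_of_star_dotProduct_eq_one {ι : Type*} [Fintype ι] {x y : ι → ℂ}
    (hx : star x ⬝ᵥ x = 1) (hy : star y ⬝ᵥ y = 1) (hyx : star y ⬝ᵥ x = 1) : x = y := by
  have hxy : star x ⬝ᵥ y = 1 := by rw [Matrix.star_dotProduct, hyx, star_one]
  rw [← sub_eq_zero, ← dotProduct_star_self_eq_zero]
  simp [star_sub, sub_dotProduct, dotProduct_sub, hx, hy, hyx, hxy]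

theorem transferAt_of_vertexEvolution (h : ∀ v, 0 < G.degree v) {u v : V} {τ : ℕ} (huv : u ≠ v)
    (hM : vertexEvolution G τ v u = 1) : TransferAt G u v τ := by
  refine ⟨isState_vertexState G h u, isState_vertexState G h v,
    fun e => huv (vertexState_injective G h e), 1, by simp, ?_⟩
  rw [one_smul]
  refine eq_of_star_dotProduct_eq_one ?_ (isState_vertexState G h v) ?_
  · rw [Matrix.star_mulVec, ← Matrix.dotProduct_mulVec, Matrix.mulVec_mulVec,
      conjTranspose_timeEvolution_pow_mul G h, Matrix.one_mulVec]
    exact isState_vertexState G h u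
  · rw [star_dotProduct_vertexState G]
    exact hM

end Graph

end GroverWalk

/-! ### Characters of `ℤ/nℤ` and the spectral criterion. -/

namespace GroverWalk

open ZMod (stdAddChar)

/-- All nonempty fibres of a group homomorphism have the size of its kernel. -/
theorem sum_comp_monoidHom_mul_card_image {G M R : Type*} [Group G] [Fintype G] [Monoid M]
    [DecidableEq M] [CommSemiring R] (φ : G →* M) (F : M → R) :
    (∑ g, F (φ g)) * ((Finset.univ.image φ).card : R) =
      (∑ m ∈ Finset.univ.image φ, F m) * (Fintype.card G : R) := by
  have hc : ∀ m ∈ Finset.univ.image φ,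
      (Finset.univ.filter fun g => φ g = m).card = (Finset.univ.filter fun g => φ g = 1).card := by
    intro m hm
    obtain ⟨g, -, rfl⟩ := Finset.mem_image.mp hm
    exact MonoidHom.card_fiber_eq_of_mem_range φ ⟨g, rfl⟩ ⟨1, map_one φ⟩
  have hmap : ∀ g ∈ (Finset.univ : Finset G), φ g ∈ Finset.univ.image φ := fun g _ =>
    Finset.mem_image_of_mem _ (Finset.mem_univ g)
  have h1 : ∑ g, F (φ g) = (Finset.univ.filter fun g => φ g = 1).card *
      ∑ m ∈ Finset.univ.image φ, F m := by
    rw [← Finset.sum_fiberwise_of_maps_to hmap, Finset.mul_sum]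
    refine Finset.sum_congr rfl fun m hm => ?_
    rw [Finset.sum_congr rfl fun g hg => by rw [(Finset.mem_filter.mp hg).2], Finset.sum_const,
      hc m hm, nsmul_eq_mul]
  have h2 : Fintype.card G = (Finset.univ.image φ).card *
      (Finset.univ.filter fun g => φ g = 1).card := by
    rw [← Finset.card_univ, Finset.card_eq_sum_card_fiberwise hmap, Finset.sum_congr rfl hc,
      Finset.sum_const, smul_eq_mul]
  rw [h1, h2]
  push_cast
  ring

theorem sum_comp_monoidHom_div_card {G M K : Type*} [Group G] [Fintype G] [Monoid M]
    [DecidableEq M] [Field K] [CharZero K] (φ : G →* M) (F : M → K) :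
    (∑ g, F (φ g)) / Fintype.card G =
      (∑ m ∈ Finset.univ.image φ, F m) / (Finset.univ.image φ).card := by
  have h : (Finset.univ.image φ).card ≠ 0 :=
    Finset.card_ne_zero.mpr (Finset.univ_nonempty.image _)
  rw [div_eq_div_iff (by exact_mod_cast Fintype.card_ne_zero) (by exact_mod_cast h)]
  exact sum_comp_monoidHom_mul_card_image φ F

/-- The homomorphism `(r, ε) ↦ ε r²` whose image is the connection set. -/
def signedSquare (n : ℕ) : (ZMod n)ˣ × ℤˣ →* ZMod n :=
  ((Int.castRingHom (ZMod n)).toMonoidHom.comp ((Units.coeHom ℤ).comp (MonoidHom.snd _ _))) *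
    (powMonoidHom 2).comp ((Units.coeHom (ZMod n)).comp (MonoidHom.fst _ _))

theorem signedSquare_apply (n : ℕ) (r : (ZMod n)ˣ) (ε : ℤˣ) :
    signedSquare n (r, ε) = ((ε : ℤ) : ZMod n) * (r : ZMod n) ^ 2 := rfl

theorem neg_mem_connectionSet {n : ℕ} {x : ZMod n} (hx : x ∈ connectionSet n) : -x ∈ connectionSet n :=
  hx.elim (fun h => Or.inr (by rwa [neg_neg])) Or.inl

theorem zero_notMem_connectionSet {n : ℕ} (hn : 2 ≤ n) : (0 : ZMod n) ∉ connectionSet n := by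
  have : Fact (1 < n) := ⟨hn⟩
  have h0 : ∀ r : (ZMod n)ˣ, (0 : ZMod n) ≠ (r : ZMod n) ^ 2 := fun r h => by
    have := (r ^ 2).ne_zero
    exact this (by rw [Units.val_pow_eq_pow_val, ← h])
  rintro (⟨r, hr⟩ | ⟨r, hr⟩)
  · exact h0 r hr
  · exact h0 r (by rw [← hr, neg_zero])

variable (n : ℕ) [NeZero n]

theorem image_signedSquare :
    Finset.univ.image (signedSquare n) = Finset.univ.filter (· ∈ connectionSet n) := by
  ext x
  rw [Finset.mem_filter]
  simp only [Finset.mem_image, Finset.mem_univ, true_and, connectionSet,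
    unitSquares, Set.mem_ofPred_eq, Prod.exists, signedSquare_apply]
  constructor
  · rintro ⟨r, ε, rfl⟩
    rcases Int.units_eq_one_or ε with rfl | rfl
    · exact Or.inl ⟨r, by simp⟩
    · exact Or.inr ⟨r, by simp⟩
  · rintro (⟨r, rfl⟩ | ⟨r, hr⟩)
    · exact ⟨r, 1, by simp⟩
    · exact ⟨r, -1, by rw [← hr]; simp⟩

variable {n} in
theorem neighborFinset_quadraticUnitaryCayleyGraph (hn : 2 ≤ n) (v : ZMod n) :
    (quadraticUnitaryCayleyGraph n).neighborFinset v =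
      (Finset.univ.image (signedSquare n)).map (addLeftEmbedding v) := by
  rw [image_signedSquare]
  ext w
  rw [SimpleGraph.mem_neighborFinset]
  simp only [quadraticUnitaryCayleyGraph, SimpleGraph.circulantGraph_adj, Finset.mem_map, Finset.mem_filter, Finset.mem_univ, true_and,
    addLeftEmbedding_apply]
  constructor
  · rintro ⟨-, h | h⟩
    · exact ⟨w - v, by simpa using neg_mem_connectionSet h, by ring⟩
    · exact ⟨w - v, h, by ring⟩
  · rintro ⟨s, hs, rfl⟩
    refine ⟨fun h => zero_notMem_connectionSet hn ?_, Or.inr (by simpa using hs)⟩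
    have : s = 0 := by simpa using h
    rwa [← this]

variable {n} in
theorem isRegularOfDegree_quadraticUnitaryCayleyGraph (hn : 2 ≤ n) :
    (quadraticUnitaryCayleyGraph n).IsRegularOfDegree (Finset.univ.image (signedSquare n)).card := by
  intro v
  rw [← SimpleGraph.card_neighborFinset_eq_degree, neighborFinset_quadraticUnitaryCayleyGraph hn,
    Finset.card_map]

variable {n} in
theorem degree_quadraticUnitaryCayleyGraph_pos (hn : 2 ≤ n) (v : ZMod n) :
    0 < (quadraticUnitaryCayleyGraph n).degree v := by
  rw [(isRegularOfDegree_quadraticUnitaryCayleyGraph hn).degree_eq, Finset.card_pos]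
  exact Finset.univ_nonempty.image _

/-- The eigenvalues of the transition matrix of the simple random walk on the quadratic unitary
Cayley graph, as averages over the units. -/
noncomputable def walkEigenvalue (k : ZMod n) : ℝ :=
  (∑ r : (ZMod n)ˣ, (stdAddChar (k * (r : ZMod n) ^ 2)).re) / Fintype.card (ZMod n)ˣ

theorem stdAddChar_add_stdAddChar_neg (x : ZMod n) :
    stdAddChar x + stdAddChar (-x) = ((2 * (stdAddChar x).re : ℝ) : ℂ) := by
  rw [AddChar.map_neg_eq_conj, Complex.add_conj]

/-- The connection set is the image of `signedSquare`, so its average may be taken over pairs `(r,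
ε)`; summing over the sign `ε` leaves twice the real part. -/
theorem sum_image_signedSquare (k : ZMod n) :
    (∑ s ∈ Finset.univ.image (signedSquare n), stdAddChar (k * s)) /
      (Finset.univ.image (signedSquare n)).card = (walkEigenvalue n k : ℂ) := by
  rw [← sum_comp_monoidHom_div_card (signedSquare n) fun s => stdAddChar (k * s),
    Fintype.sum_prod_type, walkEigenvalue]
  have h : ∀ r : (ZMod n)ˣ, ∑ ε : ℤˣ, stdAddChar (k * signedSquare n (r, ε)) =
      ((2 * (stdAddChar (k * (r : ZMod n) ^ 2)).re : ℝ) : ℂ) := by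
    intro r
    rw [← stdAddChar_add_stdAddChar_neg, UnitsInt.univ, Finset.sum_pair (by decide), signedSquare_apply, signedSquare_apply]
    simp
  rw [Finset.sum_congr rfl fun r _ => h r, Fintype.card_prod]
  have h2 : Fintype.card ℤˣ = 2 := rfl
  rw [h2]
  push_cast
  rw [← Finset.mul_sum, mul_comm, mul_div_mul_right _ _ two_ne_zero]

variable {n}

theorem stdAddChar_vecMul_discriminant (hn : 2 ≤ n) (k : ZMod n) :
    (fun x => stdAddChar (k * x)) ᵥ* discriminant (quadraticUnitaryCayleyGraph n) =
      (walkEigenvalue n k : ℂ) • fun x => stdAddChar (k * x) := by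
  ext v
  rw [vecMul_discriminant_apply _ (isRegularOfDegree_quadraticUnitaryCayleyGraph hn),
    neighborFinset_quadraticUnitaryCayleyGraph hn, Finset.sum_map, ← sum_image_signedSquare]
  simp only [addLeftEmbedding_apply, mul_add, AddChar.map_add_eq_mul, ← Finset.mul_sum,
    Pi.smul_apply, smul_eq_mul]
  ring

theorem walkEigenvalue_zero : walkEigenvalue n 0 = 1 := by
  simp [walkEigenvalue]

theorem walkEigenvalue_neg (k : ZMod n) : walkEigenvalue n (-k) = walkEigenvalue n k := by
  simp only [walkEigenvalue, neg_mul, AddChar.map_neg_eq_conj, Complex.conj_re]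

theorem TransferAt.two_le {u v : ZMod n} {τ : ℕ}
    (ht : TransferAt (quadraticUnitaryCayleyGraph n) u v τ) : 2 ≤ n := by
  by_contra h
  have h1 : n = 1 := by have := NeZero.ne n; omega
  subst h1
  exact ht.ne _ (Subsingleton.elim _ _)

/-- The character criterion for perfect state transfer. -/
theorem transferAt_iff {u v : ZMod n} {τ : ℕ} :
    TransferAt (quadraticUnitaryCayleyGraph n) u v τ ↔
      u ≠ v ∧ ∀ k : ZMod n, (((Polynomial.Chebyshev.T ℝ τ).eval (walkEigenvalue n k) : ℝ) : ℂ) =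
        stdAddChar (k * (v - u)) := by
  have key : ∀ (k : ZMod n) (c : ℂ), c = stdAddChar (k * (v - u)) ↔
      c * stdAddChar (k * u) = stdAddChar (k * v) := by
    intro k c
    have hz : stdAddChar (k * u) ≠ 0 := by
      rw [ZMod.stdAddChar_apply]
      exact Circle.coe_ne_zero _
    rw [mul_sub, AddChar.map_sub_eq_div, eq_div_iff hz]
  constructor
  · intro ht
    have hn := ht.two_le
    refine ⟨ht.ne, fun k => ?_⟩
    obtain ⟨γ, hγ⟩ := ht.exists_eval_mul_eq _ (degree_quadraticUnitaryCayleyGraph_pos hn)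
    have h0 := hγ _ _ (stdAddChar_vecMul_discriminant hn 0)
    have hk := hγ _ _ (stdAddChar_vecMul_discriminant hn k)
    -- The trivial character has eigenvalue 1, and `T_τ(1) = 1`.
    have h1 : γ = 1 := by simpa [walkEigenvalue_zero] using h0.symm
    rw [key, Polynomial.Chebyshev.complex_ofReal_eval_T, hk, h1, one_mul]
  · rintro ⟨huv, h⟩
    have hn : 2 ≤ n := by
      by_contra hn
      have h1 : n = 1 := by have := NeZero.ne n; omega
      subst h1
      exact huv (Subsingleton.elim _ _)
    refine transferAt_of_vertexEvolution _ (degree_quadraticUnitaryCayleyGraph_pos hn) huv ?_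
    set M := vertexEvolution (quadraticUnitaryCayleyGraph n) τ
    -- By Fourier inversion, column `u` is determined by its pairings with characters. The transform
    -- uses `χ(-kx)`, hence the eigenvector at `-k`.
    have hM : (fun x => M x u) = Pi.single v 1 := by
      apply (ZMod.dft (N := n) (E := ℂ)).injective
      ext k
      rw [ZMod.dft_apply, ZMod.dft_apply]
      have h1 := congrFun (vecMul_vertexEvolution _ (degree_quadraticUnitaryCayleyGraph_pos hn)
        (stdAddChar_vecMul_discriminant hn (-k)) τ) u
      rw [← Polynomial.Chebyshev.complex_ofReal_eval_T, h (-k), Pi.smul_apply, smul_eq_mul,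
        (key _ _).mp rfl] at h1
      simp only [Matrix.vecMul, dotProduct] at h1
      simpa [Pi.single_apply, mul_comm] using h1
    rw [congrFun hM v, Pi.single_eq_same]

/-- The eigenvalues at `1` and `-1` agree, so the faithful character takes equal values at `v - u`
and its negative. -/
theorem TransferAt.two_mul_sub_eq_zero {u v : ZMod n} {τ : ℕ}
    (ht : TransferAt (quadraticUnitaryCayleyGraph n) u v τ) : 2 * (v - u) = 0 := by
  obtain ⟨-, h⟩ := transferAt_iff.mp ht
  have h1 := h 1
  have h2 := h (-1)
  rw [walkEigenvalue_neg, h1] at h2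
  have := ZMod.injective_stdAddChar h2
  linear_combination this

theorem stdAddChar_natCast_mul (k : ℕ) (x : ZMod n) :
    stdAddChar ((k : ZMod n) * x) = stdAddChar x ^ k := by
  rw [← nsmul_eq_mul, AddChar.map_nsmul_eq_pow]

theorem stdAddChar_eq_neg_one {x : ZMod n} (h2 : 2 * x = 0) (h0 : x ≠ 0) :
    stdAddChar x = -1 := by
  have h : stdAddChar x ^ 2 = 1 := by
    rw [← stdAddChar_natCast_mul, Nat.cast_two, h2, AddChar.map_zero_eq_one]
  refine (eq_or_eq_neg_of_sq_eq_sq _ 1 (by rw [h, one_pow])).resolve_left fun h1 => h0 ?_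
  apply ZMod.injective_stdAddChar
  rw [h1, AddChar.map_zero_eq_one]

theorem even_of_two_mul_eq_zero {x : ZMod n} (h2 : 2 * x = 0) (h0 : x ≠ 0) : Even n := by
  have h : stdAddChar x ^ n = 1 := by
    rw [← stdAddChar_natCast_mul, ZMod.natCast_self, zero_mul, AddChar.map_zero_eq_one]
  rw [stdAddChar_eq_neg_one h2 h0] at h
  exact (neg_one_pow_eq_one_iff_even (by norm_num)).mp h

/-- Perfect state transfer occurs exactly between antipodal vertices, at the times at which the
Chebyshev polynomial takes alternating signs on the eigenvalues. -/
theorem transferAt_iff_forall_nat {u v : ZMod n} {τ : ℕ} :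
    TransferAt (quadraticUnitaryCayleyGraph n) u v τ ↔
      u ≠ v ∧ 2 * (v - u) = 0 ∧
        ∀ k : ℕ, (Polynomial.Chebyshev.T ℝ τ).eval (walkEigenvalue n k) = (-1) ^ k := by
  have key : u ≠ v → 2 * (v - u) = 0 → ∀ k : ℕ, stdAddChar ((k : ZMod n) * (v - u)) =
      (((-1) ^ k : ℝ) : ℂ) := fun h h2 k => by
    rw [stdAddChar_natCast_mul, stdAddChar_eq_neg_one h2 (sub_ne_zero.mpr h.symm)]
    simp
  constructor
  · intro ht
    refine ⟨ht.ne, ht.two_mul_sub_eq_zero, fun k => ?_⟩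
    have := (transferAt_iff.mp ht).2 k
    rw [key ht.ne ht.two_mul_sub_eq_zero] at this
    exact_mod_cast this
  · rintro ⟨h, h2, hT⟩
    refine transferAt_iff.mpr ⟨h, fun k => ?_⟩
    have := key h h2 k.val
    rw [ZMod.natCast_zmod_val] at this
    rw [this, ← hT k.val, ZMod.natCast_zmod_val]

theorem exhibitsTransfer_iff :
    ExhibitsTransfer (quadraticUnitaryCayleyGraph n) ↔
      Even n ∧ ∃ τ : ℕ, ∀ k : ℕ,
        (Polynomial.Chebyshev.T ℝ τ).eval (walkEigenvalue n k) = (-1) ^ k := by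
  constructor
  · rintro ⟨u, v, τ, ht⟩
    obtain ⟨h, h2, hT⟩ := transferAt_iff_forall_nat.mp ht
    exact ⟨even_of_two_mul_eq_zero h2 (sub_ne_zero.mpr h.symm), τ, hT⟩
  · rintro ⟨⟨m, hm⟩, τ, hT⟩
    refine ⟨0, m, τ, transferAt_iff_forall_nat.mpr ⟨fun h => ?_, ?_, hT⟩⟩
    · have := (ZMod.natCast_eq_zero_iff m n).mp h.symm
      have h1 := Nat.le_of_dvd (by have := NeZero.pos n; omega) this
      have := NeZero.pos n
      omega
    · rw [sub_zero, two_mul, ← Nat.cast_add, ← hm, ZMod.natCast_self]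

end GroverWalk

namespace GroverWalk

open ZMod (stdAddChar)
open Real Polynomial

/-! ### Evaluating the eigenvalues. -/

section Eigenvalues

variable {n : ℕ} [NeZero n]

theorem re_stdAddChar_natCast (j : ℕ) :
    (stdAddChar ((j : ℕ) : ZMod n)).re = cos (2 * π * j / n) := by
  have h : (2 * π * Complex.I * ((j : ℤ) : ℂ) / n : ℂ) = ((2 * π * j / n : ℝ) : ℂ) * Complex.I := by
    push_cast
    ring
  rw [← Int.cast_natCast (R := ZMod n), ZMod.stdAddChar_coe, h, Complex.exp_ofReal_mul_I_re]

theorem stdAddChar_div_mul {m : ℕ} [NeZero m] (h : m ∣ n) (x : ZMod n) :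
    stdAddChar (((n / m : ℕ) : ZMod n) * x) = stdAddChar (ZMod.castHom h (ZMod m) x) := by
  obtain ⟨j, rfl⟩ := ZMod.natCast_zmod_surjective x
  rw [map_natCast, ← Nat.cast_mul, ← Int.cast_natCast, ← Int.cast_natCast (n := j),
    ZMod.stdAddChar_coe, ZMod.stdAddChar_coe]
  have hn : (n : ℂ) ≠ 0 := NeZero.ne _
  have hm : (m : ℂ) ≠ 0 := NeZero.ne _
  congr 1
  rw [Int.cast_natCast, Int.cast_natCast, Nat.cast_mul, Nat.cast_div h hm]
  field_simp

/-- The character factors through `ZMod m`, and reduction of units is surjective, so averages over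
the units agree. -/
theorem walkEigenvalue_div_mul {m : ℕ} [NeZero m] (h : m ∣ n) (k : ℕ) :
    walkEigenvalue n ((n / m * k : ℕ) : ZMod n) = walkEigenvalue m (k : ZMod m) := by
  have hs : Finset.univ.image (ZMod.unitsMap h) = Finset.univ :=
    Finset.image_univ_of_surjective (ZMod.unitsMap_surjective h)
  have := sum_comp_monoidHom_div_card (ZMod.unitsMap h) fun r : (ZMod m)ˣ =>
    (stdAddChar ((k : ZMod m) * (r : ZMod m) ^ 2)).re
  rw [hs, Finset.card_univ] at this
  rw [walkEigenvalue, walkEigenvalue, ← this]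
  congr 1
  refine Finset.sum_congr rfl fun r _ => ?_
  rw [Nat.cast_mul, mul_assoc, stdAddChar_div_mul h, map_mul, map_pow, map_natCast]
  rfl

/-- Since `q ∣ m`, `m² = 0` in `ZMod n`, so replacing `r` by `r(1 + jm)` multiplies its summand by
`ζ_r ^ j`. Here `ζ_r` is a `q`-th root of unity, nontrivial because `q ∤ 2k`, so summing over `j <
q` annihilates every term. -/
theorem sum_stdAddChar_mul_sq_eq_zero {q m k : ℕ} (hn : n = q * m) (hq : q ∣ m)
    (hk : ¬ q ∣ 2 * k) : ∑ r : (ZMod n)ˣ, stdAddChar ((k : ZMod n) * (r : ZMod n) ^ 2) = 0 := by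
  have hm0 : (m : ZMod n) * m = 0 := by
    rw [← Nat.cast_mul, ZMod.natCast_eq_zero_iff, hn]
    exact Nat.mul_dvd_mul_right hq m
  have hq0 : q ≠ 0 := by
    rintro rfl
    exact NeZero.ne n (by simpa using hn)
  have hmpos : 0 < m := by
    rcases Nat.eq_zero_or_pos m with rfl | h
    · exact absurd (by simpa using hn) (NeZero.ne n)
    · exact h
  let u : ℕ → (ZMod n)ˣ := fun j =>
    ⟨1 + j * m, 1 - j * m, by linear_combination (-(j : ZMod n) ^ 2) * hm0,
      by linear_combination (-(j : ZMod n) ^ 2) * hm0⟩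
  let ζ : (ZMod n)ˣ → ℂ := fun r => stdAddChar (2 * m * k * (r : ZMod n) ^ 2 : ZMod n)
  have hζq : ∀ r : (ZMod n)ˣ, ζ r ^ q = 1 := by
    intro r
    have : (q : ZMod n) * (2 * m * k * (r : ZMod n) ^ 2) = 0 := by
      have h0 : (q : ZMod n) * m = 0 := by rw [← Nat.cast_mul, ← hn, ZMod.natCast_self]
      linear_combination (2 * k * (r : ZMod n) ^ 2) * h0
    rw [← stdAddChar_natCast_mul, this, AddChar.map_zero_eq_one]
  have hζ1 : ∀ r : (ZMod n)ˣ, ζ r ≠ 1 := by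
    intro r hr
    have h0 : (2 * m * k * (r : ZMod n) ^ 2 : ZMod n) = 0 :=
      ZMod.injective_stdAddChar (by rw [AddChar.map_zero_eq_one]; exact hr)
    rw [← Units.val_pow_eq_pow_val, Units.mul_left_eq_zero] at h0
    have h1 : ((2 * m * k : ℕ) : ZMod n) = 0 := by exact_mod_cast h0
    rw [ZMod.natCast_eq_zero_iff, hn] at h1
    refine hk (Nat.dvd_of_mul_dvd_mul_right hmpos ?_)
    rwa [show 2 * k * m = 2 * m * k by ring]
  have hgeom : ∀ r, ∑ j ∈ Finset.range q, ζ r ^ j = 0 := by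
    intro r
    have := mul_neg_geom_sum (ζ r) q
    rw [hζq, sub_self] at this
    exact (mul_eq_zero.mp this).resolve_left (sub_ne_zero.mpr (hζ1 r).symm)
  have hshift : ∀ j : ℕ, ∑ r : (ZMod n)ˣ, stdAddChar ((k : ZMod n) * (r : ZMod n) ^ 2) =
      ∑ r : (ZMod n)ˣ, stdAddChar ((k : ZMod n) * (r : ZMod n) ^ 2) * ζ r ^ j := by
    intro j
    rw [← Equiv.sum_comp (Equiv.mulRight (u j))]
    refine Finset.sum_congr rfl fun r _ => ?_
    rw [← stdAddChar_natCast_mul, ← AddChar.map_add_eq_mul]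
    congr 1
    have hu : ((u j : (ZMod n)ˣ) : ZMod n) = 1 + j * m := rfl
    rw [Equiv.coe_mulRight, Units.val_mul, hu]
    linear_combination ((k : ZMod n) * (r : ZMod n) ^ 2 * j ^ 2) * hm0
  have h : (q : ℂ) * ∑ r : (ZMod n)ˣ, stdAddChar ((k : ZMod n) * (r : ZMod n) ^ 2) = 0 := by
    rw [← nsmul_eq_mul, ← Finset.card_range q, ← Finset.sum_const,
      Finset.sum_congr rfl fun j _ => hshift j, Finset.sum_comm]
    refine Finset.sum_eq_zero fun r _ => ?_
    rw [← Finset.mul_sum, hgeom, mul_zero]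
  exact (mul_eq_zero.mp h).resolve_left (by exact_mod_cast hq0)

theorem walkEigenvalue_eq_zero {q m k : ℕ} (hn : n = q * m) (hq : q ∣ m) (hk : ¬ q ∣ 2 * k) :
    walkEigenvalue n k = 0 := by
  have := congrArg Complex.re (sum_stdAddChar_mul_sq_eq_zero hn hq hk)
  rw [Complex.re_sum, Complex.zero_re] at this
  rw [walkEigenvalue, this, zero_div]

/-- Multiplication by `w` permutes the units and interchanges the two possible squares, so averaging
the sum with its translate makes every term constant. -/
theorem walkEigenvalue_of_sq_eq_or (w : (ZMod n)ˣ) (hw : w ^ 2 * w ^ 2 = 1)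
    (h : ∀ r : (ZMod n)ˣ, r ^ 2 = 1 ∨ r ^ 2 = w ^ 2) (k : ZMod n) :
    walkEigenvalue n k = ((stdAddChar k).re + (stdAddChar (k * (w : ZMod n) ^ 2)).re) / 2 := by
  set f : (ZMod n)ˣ → ℝ := fun r => (stdAddChar (k * (r : ZMod n))).re with hf
  have h1 : ∑ r : (ZMod n)ˣ, f (r ^ 2) = ∑ r : (ZMod n)ˣ, f (r ^ 2 * w ^ 2) := by
    rw [← Equiv.sum_comp (Equiv.mulRight w)]
    simp only [Equiv.coe_mulRight, mul_pow]
  have h2 : ∀ r : (ZMod n)ˣ, f (r ^ 2) + f (r ^ 2 * w ^ 2) = f 1 + f (w ^ 2) := by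
    intro r
    rcases h r with h | h
    · rw [h, one_mul]
    · rw [h, hw, add_comm]
  have h3 : ∑ r : (ZMod n)ˣ, f (r ^ 2) + ∑ r : (ZMod n)ˣ, f (r ^ 2) =
      Fintype.card (ZMod n)ˣ * (f 1 + f (w ^ 2)) := by
    nth_rw 2 [h1]
    rw [← Finset.sum_add_distrib, Finset.sum_congr rfl fun r _ => h2 r, Finset.sum_const,
      Finset.card_univ, nsmul_eq_mul]
  have hc : (Fintype.card (ZMod n)ˣ : ℝ) ≠ 0 := by exact_mod_cast Fintype.card_ne_zero
  have h4 : walkEigenvalue n k = (∑ r : (ZMod n)ˣ, f (r ^ 2)) / Fintype.card (ZMod n)ˣ := by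
    simp [walkEigenvalue, hf]
  have h5 : f 1 + f (w ^ 2) = (stdAddChar k).re + (stdAddChar (k * (w : ZMod n) ^ 2)).re := by
    simp [hf]
  rw [h4, ← h5, div_eq_div_iff hc two_ne_zero]
  linarith

theorem walkEigenvalue_of_sq_eq_one_or_neg_one
    (h : ∀ r : (ZMod n)ˣ, (r : ZMod n) ^ 2 = 1 ∨ (r : ZMod n) ^ 2 = -1) (k : ℕ) :
    walkEigenvalue n k = cos (2 * π * k / n) := by
  have h2 : ∀ r : (ZMod n)ˣ, (stdAddChar ((k : ZMod n) * (r : ZMod n) ^ 2)).re =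
      cos (2 * π * k / n) := by
    intro r
    rw [← re_stdAddChar_natCast]
    rcases h r with h | h
    · simp [h]
    · simp [h, AddChar.map_neg_eq_conj]
  have hc : (Fintype.card (ZMod n)ˣ : ℝ) ≠ 0 := by exact_mod_cast Fintype.card_ne_zero
  rw [walkEigenvalue, Finset.sum_congr rfl fun r _ => h2 r, Finset.sum_const, Finset.card_univ,
    nsmul_eq_mul, mul_div_cancel_left₀ _ hc]

theorem walkEigenvalue_of_sq_eq_one_or (w : ℕ) (hw : w.Coprime n) (hw2 : (w : ZMod n) ^ 4 = 1)
    (h : ∀ r : (ZMod n)ˣ, (r : ZMod n) ^ 2 = 1 ∨ (r : ZMod n) ^ 2 = ((w ^ 2 : ℕ) : ZMod n)) (k : ℕ) :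
    walkEigenvalue n k =
      cos (π * k * (w ^ 2 + 1) / n) * cos (π * k * (w ^ 2 - 1) / n) := by
  have hu : ((ZMod.unitOfCoprime w hw : (ZMod n)ˣ) : ZMod n) = w := rfl
  have h1 := walkEigenvalue_of_sq_eq_or (ZMod.unitOfCoprime w hw)
    (by ext; push_cast [hu]; linear_combination hw2)
    (fun r => (h r).imp (fun h => by ext; push_cast; exact h)
      fun h => by ext; push_cast [hu] at h ⊢; exact h) (k : ZMod n)
  rw [hu, ← Nat.cast_pow, ← Nat.cast_mul, re_stdAddChar_natCast, re_stdAddChar_natCast,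
    Real.cos_add_cos] at h1
  rw [h1, ← Real.cos_neg (π * k * (w ^ 2 - 1) / n)]
  push_cast
  rw [show (2 * π * k / n + 2 * π * (k * w ^ 2) / n) / 2 = π * k * (w ^ 2 + 1) / n by ring,
    show (2 * π * k / n - 2 * π * (k * w ^ 2) / n) / 2 = -(π * k * (w ^ 2 - 1) / n) by ring]
  ring

/-- The hypothesis is bounded arithmetic on naturals, so that `decide` settles each concrete `n`. -/
theorem units_sq_eq_one_or (c : ℕ)
    (h : ∀ k < n, k.gcd n = 1 → k ^ 2 % n = 1 % n ∨ k ^ 2 % n = c % n) (r : (ZMod n)ˣ) :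
    (r : ZMod n) ^ 2 = 1 ∨ (r : ZMod n) ^ 2 = (c : ZMod n) := by
  rw [← ZMod.natCast_zmod_val (r : ZMod n), ← Nat.cast_pow, ← Nat.cast_one,
    ZMod.natCast_eq_natCast_iff, ZMod.natCast_eq_natCast_iff]
  exact h _ (ZMod.val_lt _) (ZMod.val_coe_unit_coprime r)

end Eigenvalues

/-! ### Algebraic integers from Chebyshev values. -/

section Integrality

/-- The index starts at 1 because the zeroth polynomial is the constant 2. -/
theorem monic_natDegree_chebyshev_C (τ : ℕ) :
    (Chebyshev.C ℤ (τ + 1)).Monic ∧ (Chebyshev.C ℤ (τ + 1)).natDegree = τ + 1 := by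
  induction τ using Nat.twoStepInduction with
  | zero => simp [monic_X]
  | one =>
    have : (Chebyshev.C ℤ 2) = X ^ 2 - C 2 := by rw [Chebyshev.C_two]; rfl
    norm_num
    rw [this]
    exact ⟨monic_X_pow_sub_C _ two_ne_zero, natDegree_X_pow_sub_C⟩
  | more τ ih₀ ih₁ =>
    have hrec : Chebyshev.C ℤ ((τ + 2 : ℕ) + 1) =
        X * Chebyshev.C ℤ ((τ + 1 : ℕ) + 1) - Chebyshev.C ℤ (τ + 1) := by
      have := Chebyshev.C_add_two ℤ (τ + 1)
      push_cast
      rw [← this]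
      congr 1
    have hX : (X * Chebyshev.C ℤ ((τ + 1 : ℕ) + 1)).Monic := monic_X.mul ih₁.1
    have hdeg : (X * Chebyshev.C ℤ ((τ + 1 : ℕ) + 1)).natDegree = τ + 2 + 1 := by
      rw [monic_X.natDegree_mul ih₁.1, ih₁.2, natDegree_X]
      ring
    have hlt : (Chebyshev.C ℤ (τ + 1)).degree < (X * Chebyshev.C ℤ ((τ + 1 : ℕ) + 1)).degree := by
      apply degree_lt_degree
      rw [hdeg, ih₀.2]
      omega
    rw [hrec]
    exact ⟨hX.sub_of_left hlt, by rw [natDegree_sub_eq_left_of_natDegree_lt (by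
      rw [hdeg, ih₀.2]; omega), hdeg]⟩

/-- The monic integer polynomial `C_τ` satisfies `C_τ(2x) = 2 T_τ(x)`. -/
theorem isIntegral_two_mul_of_eval_T {x : ℝ} {τ : ℕ} (hτ : τ ≠ 0)
    (h : IsIntegral ℤ ((Chebyshev.T ℝ τ).eval x)) : IsIntegral ℤ (2 * x) := by
  obtain ⟨σ, rfl⟩ := Nat.exists_eq_succ_of_ne_zero hτ
  obtain ⟨hm, hd⟩ := monic_natDegree_chebyshev_C σ
  refine IsIntegral.of_aeval_monic hm (by rw [hd]; omega) ?_
  rw [Chebyshev.aeval_C]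
  have h1 := congrArg (eval x) (Chebyshev.C_comp_two_mul_X ℝ (σ + 1))
  simp only [eval_comp, eval_mul, eval_ofNat, eval_X] at h1
  rw [h1]
  have h2 : IsIntegral ℤ (2 : ℝ) := by exact_mod_cast isIntegral_algebraMap (R := ℤ) (x := 2)
  exact h2.mul (by exact_mod_cast h)

theorem not_isIntegral_one_half : ¬ IsIntegral ℤ (1 / 2 : ℝ) := by
  intro h
  obtain ⟨k, hk⟩ := h.exists_int_iff_exists_rat.mp ⟨1 / 2, by norm_num⟩
  have : (1 : ℝ) = ((2 * k : ℤ) : ℝ) := by push_cast; linarith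
  have : (1 : ℤ) = 2 * k := by exact_mod_cast this
  omega

theorem isIntegral_two_mul_cos_pi_div_five_sub_one : IsIntegral ℤ (2 * cos (π / 5) - 1) := by
  have h2 : IsIntegral ℤ (2 * cos (π / 5)) := by
    refine isIntegral_two_mul_of_eval_T (τ := 5) (by norm_num) ?_
    rw [Chebyshev.T_real_cos]
    rw [show (((5 : ℕ) : ℤ) : ℝ) * (π / 5) = π by push_cast; ring, cos_pi]
    exact isIntegral_one.neg
  exact h2.sub isIntegral_one

/-- This is `φ(φ - 1) = 1` for the golden ratio `φ = 2 cos (π / 5)`. Multiplying by the integral `φ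
- 1` turns `cos (π / 5)` into `1 / 2`. -/
theorem two_mul_cos_pi_div_five_mul_sub_one :
    2 * cos (π / 5) * (2 * cos (π / 5) - 1) = 1 := by
  rw [cos_pi_div_five]
  nlinarith [Real.sq_sqrt (show (0 : ℝ) ≤ 5 by norm_num)]

theorem not_isIntegral_cos_pi_div_five : ¬ IsIntegral ℤ (cos (π / 5)) := fun h =>
  not_isIntegral_one_half <| by
    have := h.mul isIntegral_two_mul_cos_pi_div_five_sub_one
    rwa [show cos (π / 5) * (2 * cos (π / 5) - 1) = 1 / 2 by
      linarith [two_mul_cos_pi_div_five_mul_sub_one]] at this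

theorem not_isIntegral_sqrt_two_mul_cos_pi_div_five : ¬ IsIntegral ℤ (√2 * cos (π / 5)) := fun h =>
  not_isIntegral_one_half <| by
    have := (h.mul isIntegral_two_mul_cos_pi_div_five_sub_one).pow 2
    rwa [mul_assoc, show cos (π / 5) * (2 * cos (π / 5) - 1) = 1 / 2 by
      linarith [two_mul_cos_pi_div_five_mul_sub_one], mul_pow, Real.sq_sqrt zero_le_two,
      show (2 * (1 / 2) ^ 2 : ℝ) = 1 / 2 by norm_num] at this

end Integrality

/-! ### Gauss-type sums modulo a prime. -/

section Prime

theorem sum_range_two_mul {M : Type*} [AddCommMonoid M] (a : ℕ → M) (N : ℕ) :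
    ∑ i ∈ Finset.range (2 * N), a i = ∑ i ∈ Finset.range N, (a (2 * i) + a (2 * i + 1)) := by
  induction N with
  | zero => simp
  | succ N ih => rw [Finset.sum_range_succ, ← ih, Nat.mul_succ, Finset.sum_range_succ,
      Finset.sum_range_succ, add_assoc]

/-- The exponents `2i` and `2i + 1` with `i < |G|` run through `0, …, 2|G| - 1`, which covers the
cyclic group twice whatever the parity of its order. -/
theorem sum_sq_add_sum_generator_mul_sq {G M : Type*} [Group G] [Fintype G] [AddCommMonoid M]
    {g : G} (hg : ∀ x, x ∈ Subgroup.zpowers g) (f : G → M) :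
    ∑ r, (f (r ^ 2) + f (g * r ^ 2)) = 2 • ∑ r, f r := by
  classical
  have key : ∀ F : G → M, ∑ r, F r = ∑ i ∈ Finset.range (Fintype.card G), F (g ^ i) := by
    intro F
    have := IsCyclic.image_range_card hg
    rw [← this, Finset.sum_image]
    · rw [Nat.card_eq_fintype_card]
    · intro i hi j hj hij
      have ho : orderOf g = Nat.card G := orderOf_eq_card_of_forall_mem_zpowers hg
      refine pow_injOn_Iio_orderOf ?_ ?_ hij <;> simp_all
  rw [key, key f, two_nsmul]
  have h := sum_range_two_mul (fun i => f (g ^ i)) (Fintype.card G)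
  have h2 : ∀ i, f (g ^ (2 * i)) + f (g ^ (2 * i + 1)) = f ((g ^ i) ^ 2) + f (g * (g ^ i) ^ 2) := by
    intro i
    rw [pow_succ', pow_mul']
  rw [Finset.sum_congr rfl fun i _ => h2 i] at h
  rw [← h, two_mul, Finset.sum_range_add]
  simp [pow_add]

theorem sum_units_stdAddChar (p : ℕ) [Fact p.Prime] :
    ∑ r : (ZMod p)ˣ, stdAddChar (r : ZMod p) = -1 := by
  have h1 : ∑ r : (ZMod p)ˣ, stdAddChar (r : ZMod p) =
      ∑ a : {a : ZMod p // a ≠ 0}, stdAddChar (a : ZMod p) :=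
    Fintype.sum_equiv unitsEquivNeZero _ _ fun r => rfl
  have h2 : ∑ a : ZMod p, stdAddChar a = (0 : ℂ) := by
    refine AddChar.sum_eq_zero_of_ne_one fun h => one_ne_zero (α := ZMod p) ?_
    apply ZMod.injective_stdAddChar
    rw [h]
    simp
  have h3 := Fintype.sum_subtype_add_sum_subtype (fun a : ZMod p => a ≠ 0)
    fun a => (stdAddChar a : ℂ)
  have h4 : ∑ a : {a : ZMod p // ¬ a ≠ 0}, (stdAddChar (a : ZMod p) : ℂ) = 1 := by
    have : ∀ a : {a : ZMod p // ¬ a ≠ 0}, (stdAddChar (a : ZMod p) : ℂ) = 1 := fun a => by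
      rw [not_not.mp a.2, AddChar.map_zero_eq_one]
    rw [Finset.sum_congr rfl fun a _ => this a]
    simp
  rw [h2, h4] at h3
  rw [h1]
  linear_combination h3

/-- Take `k` to be a generator of the units: the two sums together cover all units twice, and the
full character sum is `-1`. -/
theorem exists_walkEigenvalue_add_eq (p : ℕ) [Fact p.Prime] :
    ∃ k : ℕ, (walkEigenvalue p (1 : ℕ) + walkEigenvalue p k) * (p - 1) = -2 := by
  obtain ⟨g, hg⟩ := IsCyclic.exists_generator (α := (ZMod p)ˣ)
  refine ⟨(g : ZMod p).val, ?_⟩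
  have h := sum_sq_add_sum_generator_mul_sq hg fun r => (stdAddChar (r : ZMod p)).re
  rw [← Complex.re_sum, sum_units_stdAddChar, Finset.sum_add_distrib] at h
  have hc : (Fintype.card (ZMod p)ˣ : ℝ) = p - 1 := by
    rw [ZMod.card_units, Nat.cast_sub (Fact.out : p.Prime).one_le, Nat.cast_one]
  have hc0 : (Fintype.card (ZMod p)ˣ : ℝ) ≠ 0 := by exact_mod_cast Fintype.card_ne_zero
  rw [walkEigenvalue, walkEigenvalue, ← hc, ← add_div, div_mul_cancel₀ _ hc0]
  simpa using h

end Prime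

end GroverWalk

namespace GroverWalk

open Real Polynomial

/-- The spectral form of perfect state transfer at time `τ` for even `n`. -/
def AlternatesAt (n : ℕ) [NeZero n] (τ : ℕ) : Prop :=
  ∀ k : ℕ, (Chebyshev.T ℝ τ).eval (walkEigenvalue n k) = (-1) ^ k

theorem walkEigenvalue_eight_one : walkEigenvalue 8 (1 : ℕ) = cos (π / 4) := by
  rw [walkEigenvalue_of_sq_eq_one_or_neg_one (units_sq_eq_one_or 7 (by decide))]
  congr 1
  push_cast
  ring

theorem walkEigenvalue_fifteen_one : walkEigenvalue 15 (1 : ℕ) = cos (π / 5) / 2 := by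
  rw [walkEigenvalue_of_sq_eq_one_or 2 (by decide) (by decide)
    (units_sq_eq_one_or 4 (by decide))]
  push_cast
  rw [show π * 1 * (2 ^ 2 + 1) / 15 = π / 3 by ring, show π * 1 * (2 ^ 2 - 1) / 15 = π / 5 by ring,
    cos_pi_div_three]
  ring

theorem walkEigenvalue_forty_one : walkEigenvalue 40 (1 : ℕ) = √2 * cos (π / 5) / 2 := by
  rw [walkEigenvalue_of_sq_eq_one_or 3 (by decide) (by decide)
    (units_sq_eq_one_or 9 (by decide))]
  push_cast
  rw [show π * 1 * (3 ^ 2 + 1) / 40 = π / 4 by ring, show π * 1 * (3 ^ 2 - 1) / 40 = π / 5 by ring,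
    cos_pi_div_four]
  ring

theorem walkEigenvalue_twenty (k : ℕ) :
    walkEigenvalue 20 k = cos (k * (π / 2)) * cos (k * (2 * π / 5)) := by
  rw [walkEigenvalue_of_sq_eq_one_or 3 (by decide) (by decide)
    (units_sq_eq_one_or 9 (by decide))]
  congr 2 <;> (push_cast; ring)

/-! ### Necessity: excluding divisors. -/

section Necessity

variable {n : ℕ} [NeZero n] {τ : ℕ}

theorem AlternatesAt.time_ne_zero (h : AlternatesAt n τ) : τ ≠ 0 := by
  rintro rfl
  have := h 1
  norm_num at this

theorem AlternatesAt.eval_walkEigenvalue (h : AlternatesAt n τ) {m : ℕ} [NeZero m] (hm : m ∣ n)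
    (k : ℕ) : (Chebyshev.T ℝ τ).eval (walkEigenvalue m k) = (-1) ^ (n / m * k) := by
  rw [← walkEigenvalue_div_mul hm, h]

theorem AlternatesAt.isIntegral_two_mul (h : AlternatesAt n τ) {m : ℕ} [NeZero m] (hm : m ∣ n)
    (k : ℕ) : IsIntegral ℤ (2 * walkEigenvalue m k) := by
  refine isIntegral_two_mul_of_eval_T h.time_ne_zero ?_
  rw [h.eval_walkEigenvalue hm]
  exact isIntegral_one.neg.pow _

/-- Both `λ_1` and `λ_2` vanish, yet `T_τ` must take opposite signs there. -/
theorem AlternatesAt.not_sq_dvd (h : AlternatesAt n τ) {q : ℕ} (hq : Odd q) (hq1 : q ≠ 1) :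
    ¬ q ^ 2 ∣ n := by
  rintro ⟨m, hm⟩
  have hn : n = q * (q * m) := by rw [hm]; ring
  have hc : q.Coprime 2 := hq.coprime_two_right
  have h1 : ¬ q ∣ 2 * 1 := fun hd => hq1 (by simpa using hc.dvd_of_dvd_mul_left hd)
  have h2 : ¬ q ∣ 2 * 2 := fun hd => h1 (by simpa using hc.dvd_of_dvd_mul_left hd)
  have e1 := h 1
  have e2 := h 2
  rw [walkEigenvalue_eq_zero hn (dvd_mul_right q m) h1] at e1
  rw [walkEigenvalue_eq_zero hn (dvd_mul_right q m) h2, e1] at e2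
  norm_num at e2

/-- Here `λ_1 = 0` gives `cos (τπ / 2) = -1`, while the divisor 8 gives `cos (τπ / 4) = 1`; the
double-angle formula refutes this. -/
theorem AlternatesAt.not_sixteen_dvd (h : AlternatesAt n τ) : ¬ 16 ∣ n := by
  rintro ⟨m, hm⟩
  have hn : n = 4 * (4 * m) := by rw [hm]; ring
  have e1 := h 1
  rw [walkEigenvalue_eq_zero hn (dvd_mul_right 4 m) (by decide), ← cos_pi_div_two,
    Chebyshev.T_real_cos] at e1
  have e2 := h.eval_walkEigenvalue (m := 8) ⟨2 * m, by rw [hm]; ring⟩ 1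
  rw [walkEigenvalue_eight_one, Chebyshev.T_real_cos, show n / 8 * 1 = 2 * m by omega, pow_mul,
    neg_one_sq, one_pow] at e2
  have e3 := cos_two_mul (((τ : ℤ) : ℝ) * (π / 4))
  rw [e2, show 2 * (((τ : ℤ) : ℝ) * (π / 4)) = ((τ : ℤ) : ℝ) * (π / 2) by ring, e1] at e3
  norm_num at e3

theorem AlternatesAt.not_fifteen_dvd (h : AlternatesAt n τ) : ¬ 15 ∣ n := fun hd => by
  have := h.isIntegral_two_mul hd 1
  rw [walkEigenvalue_fifteen_one, mul_div_cancel₀ _ two_ne_zero] at this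
  exact not_isIntegral_cos_pi_div_five this

theorem AlternatesAt.not_forty_dvd (h : AlternatesAt n τ) : ¬ 40 ∣ n := fun hd => by
  have := h.isIntegral_two_mul hd 1
  rw [walkEigenvalue_forty_one, mul_div_cancel₀ _ two_ne_zero] at this
  exact not_isIntegral_sqrt_two_mul_cos_pi_div_five this

/-- The rational number `-4 / (p - 1)` is an algebraic integer, so `p - 1` divides 4. -/
theorem AlternatesAt.prime_le_five (h : AlternatesAt n τ) {p : ℕ} (hp : p.Prime) (hd : p ∣ n) :
    p ≤ 5 := by
  have : Fact p.Prime := ⟨hp⟩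
  obtain ⟨k, hk⟩ := exists_walkEigenvalue_add_eq p
  have hint := (h.isIntegral_two_mul hd 1).add (h.isIntegral_two_mul hd k)
  rw [← mul_add] at hint
  have hp1 : (p : ℝ) - 1 ≠ 0 := sub_ne_zero.mpr (by exact_mod_cast hp.one_lt.ne')
  have hq : 2 * (walkEigenvalue p (1 : ℕ) + walkEigenvalue p k) = ((-4 / (p - 1) : ℚ) : ℝ) := by
    push_cast at hk ⊢
    rw [eq_div_iff hp1]
    linarith
  obtain ⟨z, hz⟩ := hint.exists_int_iff_exists_rat.mp ⟨_, hq⟩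
  have hz2 : z * ((p : ℤ) - 1) = -4 := by
    have : (z : ℝ) * (p - 1) = -4 := by rw [← hz]; linarith
    exact_mod_cast this
  have hdvd : (p : ℤ) - 1 ∣ 4 := ⟨-z, by linarith⟩
  have := Int.le_of_dvd (by norm_num) hdvd
  omega

theorem AlternatesAt.dvd (h : AlternatesAt n τ) : n ∣ 120 := by
  rw [Nat.dvd_iff_prime_pow_dvd_dvd]
  intro p k hp hd
  rcases Nat.eq_zero_or_pos k with rfl | hk
  · simp
  have hp5 := h.prime_le_five hp ((dvd_pow_self p hk.ne').trans hd)
  have h2 : ∀ q, Odd q → q ≠ 1 → p = q → k = 1 := fun q hq hq1 hpq => by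
    by_contra hk1
    exact h.not_sq_dvd hq hq1 (hpq ▸ (pow_dvd_pow p (by omega)).trans hd)
  have h3 := hp.two_le
  interval_cases p
  · have hk3 : k ≤ 3 := by
      by_contra hk3
      exact h.not_sixteen_dvd ((pow_dvd_pow 2 (show 4 ≤ k by omega)).trans hd)
    exact (pow_dvd_pow 2 hk3).trans (by decide)
  · rw [h2 3 (by decide) (by decide) rfl]
    decide
  · exact absurd hp (by decide)
  · rw [h2 5 (by decide) (by decide) rfl]
    decide

theorem AlternatesAt.mem (h : AlternatesAt n τ) (he : Even n) :
    n ∈ ({2, 4, 6, 8, 12, 24, 10, 20} : Set ℕ) := by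
  have h15 := h.not_fifteen_dvd
  have h40 := h.not_forty_dvd
  have hd := h.dvd
  clear h
  have hmem : n ∈ Nat.divisors 120 := Nat.mem_divisors.mpr ⟨hd, by norm_num⟩
  have key : ∀ n ∈ Nat.divisors 120, Even n → ¬ 15 ∣ n → ¬ 40 ∣ n →
      n = 2 ∨ n = 4 ∨ n = 6 ∨ n = 8 ∨ n = 12 ∨ n = 24 ∨ n = 10 ∨ n = 20 := by
    decide +kernel
  simpa using key n hmem he h15 h40

end Necessity

/-! ### Sufficiency and the least time for `n = 20`. -/

section Sufficiency

theorem alternatesAt_of_sq_eq_one_or_neg_one {n m : ℕ} [NeZero n] (hn : n = 2 * m)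
    (h : ∀ k < n, k.gcd n = 1 → k ^ 2 % n = 1 % n ∨ k ^ 2 % n = (n - 1) % n) : AlternatesAt n m := by
  intro k
  have hm : (m : ℝ) ≠ 0 := by
    rintro h0
    have : m = 0 := by exact_mod_cast h0
    exact NeZero.ne n (by omega)
  have hc : ((n - 1 : ℕ) : ZMod n) = -1 := by
    rw [Nat.cast_sub NeZero.one_le, ZMod.natCast_self, Nat.cast_one, zero_sub]
  have hsq := units_sq_eq_one_or (n - 1) h
  rw [hc] at hsq
  rw [walkEigenvalue_of_sq_eq_one_or_neg_one hsq, Chebyshev.T_real_cos, ← Real.cos_nat_mul_pi]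
  congr 1
  rw [hn]
  push_cast
  field_simp

theorem alternatesAt_twenty : AlternatesAt 20 10 := by
  intro k
  rw [walkEigenvalue_twenty]
  rcases Nat.even_or_odd' k with ⟨j, rfl | rfl⟩
  -- The sign `(-1)^j` is absorbed as a shift by `jπ`: `4πj/5 + πj = 9πj/5`, and ten times this is a
  -- multiple of `2π`.
  · have h : cos ((2 * j : ℕ) * (π / 2)) * cos ((2 * j : ℕ) * (2 * π / 5)) =
        cos (j * (9 * π / 5)) := by
      rw [show ((2 * j : ℕ) : ℝ) * (π / 2) = j * π by push_cast; ring, Real.cos_nat_mul_pi,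
        ← Real.cos_add_nat_mul_pi]
      congr 1
      push_cast
      ring
    rw [h, Chebyshev.T_real_cos, pow_mul, neg_one_sq, one_pow, ← Real.cos_nat_mul_two_pi (9 * j)]
    congr 1
    push_cast
    ring
  -- For odd `k` the eigenvalue is 0, and `T_10(0) = cos (5π) = -1`.
  · have h : cos ((2 * j + 1 : ℕ) * (π / 2)) = 0 := by
      rw [show ((2 * j + 1 : ℕ) : ℝ) * (π / 2) = π / 2 + j * π by push_cast; ring,
        Real.cos_add_nat_mul_pi, cos_pi_div_two, mul_zero]
    rw [h, zero_mul, ← cos_pi_div_two, Chebyshev.T_real_cos, pow_succ, pow_mul, neg_one_sq,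
      one_pow, one_mul, show (((10 : ℕ) : ℤ) : ℝ) * (π / 2) = π + (2 : ℕ) * (2 * π) by
        push_cast; ring, Real.cos_add_nat_mul_two_pi, cos_pi]

/-- From `λ_1 = 0` comes `τ ≡ 2` mod 4, and from `λ_4 = cos (8π / 5)` comes `5 ∣ 4τ`. -/
theorem ten_le_of_alternatesAt_twenty {τ : ℕ} (h : AlternatesAt 20 τ) : 10 ≤ τ := by
  have hπ := Real.pi_ne_zero
  have h1 := h 1
  have h4 := h 4
  rw [walkEigenvalue_twenty] at h1 h4
  rw [Nat.cast_one, one_mul, cos_pi_div_two, zero_mul, ← cos_pi_div_two, Chebyshev.T_real_cos,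
    pow_one, Real.cos_eq_neg_one_iff] at h1
  rw [show ((4 : ℕ) : ℝ) * (π / 2) = 2 * π by push_cast; ring, cos_two_pi, one_mul,
    Chebyshev.T_real_cos, show (-1 : ℝ) ^ 4 = 1 by norm_num, Real.cos_eq_one_iff] at h4
  obtain ⟨a, ha⟩ := h1
  obtain ⟨b, hb⟩ := h4
  have ha' : (2 + 4 * a : ℝ) = τ := by
    apply mul_right_cancel₀ hπ
    push_cast at ha
    linarith
  have hb' : (5 * b : ℝ) = 4 * τ := by
    apply mul_right_cancel₀ hπ
    push_cast at hb
    linarith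
  have ha2 : 2 + 4 * a = (τ : ℤ) := by exact_mod_cast ha'
  have hb2 : 5 * b = 4 * (τ : ℤ) := by exact_mod_cast hb'
  omega

theorem exists_alternatesAt {n : ℕ} [NeZero n]
    (hn : n ∈ ({2, 4, 6, 8, 12, 24, 10, 20} : Set ℕ)) : Even n ∧ ∃ τ, AlternatesAt n τ := by
  rcases hn with rfl | rfl | rfl | rfl | rfl | rfl | rfl | rfl
  · exact ⟨by decide, 1, alternatesAt_of_sq_eq_one_or_neg_one rfl (by decide)⟩
  · exact ⟨by decide, 2, alternatesAt_of_sq_eq_one_or_neg_one rfl (by decide)⟩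
  · exact ⟨by decide, 3, alternatesAt_of_sq_eq_one_or_neg_one rfl (by decide)⟩
  · exact ⟨by decide, 4, alternatesAt_of_sq_eq_one_or_neg_one rfl (by decide)⟩
  · exact ⟨by decide, 6, alternatesAt_of_sq_eq_one_or_neg_one rfl (by decide)⟩
  · exact ⟨by decide, 12, alternatesAt_of_sq_eq_one_or_neg_one rfl (by decide)⟩
  · exact ⟨by decide, 5, alternatesAt_of_sq_eq_one_or_neg_one rfl (by decide)⟩
  · exact ⟨by decide, 10, alternatesAt_twenty⟩

end Sufficiency

theorem exhibitsTransfer_iff_mem (n : ℕ) [NeZero n] :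
    ExhibitsTransfer (quadraticUnitaryCayleyGraph n) ↔
      n ∈ ({2, 4, 6, 8, 12, 24, 10, 20} : Set ℕ) :=
  exhibitsTransfer_iff.trans ⟨fun ⟨he, _, h⟩ => AlternatesAt.mem h he, exists_alternatesAt⟩

theorem mem_iff_exists_two_pow_mul_three_pow (n : ℕ) :
    n ∈ ({2, 4, 6, 8, 12, 24, 10, 20} : Set ℕ) ↔
      (∃ α β : ℕ, 1 ≤ α ∧ α ≤ 3 ∧ β ≤ 1 ∧ n = 2 ^ α * 3 ^ β) ∨ n = 10 ∨ n = 20 := by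
  constructor
  · rintro (rfl | rfl | rfl | rfl | rfl | rfl | rfl | rfl)
    · exact Or.inl ⟨1, 0, by norm_num⟩
    · exact Or.inl ⟨2, 0, by norm_num⟩
    · exact Or.inl ⟨1, 1, by norm_num⟩
    · exact Or.inl ⟨3, 0, by norm_num⟩
    · exact Or.inl ⟨2, 1, by norm_num⟩
    · exact Or.inl ⟨3, 1, by norm_num⟩
    · exact Or.inr (Or.inl rfl)
    · exact Or.inr (Or.inr rfl)
  · rintro (⟨α, β, h1, h2, h3, rfl⟩ | rfl | rfl)
    · interval_cases α <;> interval_cases β <;> simp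
    · simp
    · simp

end GroverWalk

theorem theorem5p5 :
    (∀ (n : ℕ) [NeZero n],
      (GroverWalk.ExhibitsTransfer (GroverWalk.quadraticUnitaryCayleyGraph n) ↔
        n ∈ ({2, 4, 6, 8, 12, 24, 10, 20} : Set ℕ)) ∧
      (GroverWalk.ExhibitsTransfer (GroverWalk.quadraticUnitaryCayleyGraph n) ↔
        (∃ α β : ℕ, 1 ≤ α ∧ α ≤ 3 ∧ β ≤ 1 ∧ n = 2 ^ α * 3 ^ β) ∨ n = 10 ∨ n = 20)) ∧
    (∀ u v : ZMod 20,
      (∃ τ : ℕ, GroverWalk.TransferAt (GroverWalk.quadraticUnitaryCayleyGraph 20) u v τ) →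
        IsLeast {τ : ℕ |
          GroverWalk.TransferAt (GroverWalk.quadraticUnitaryCayleyGraph 20) u v τ} 10) := by
  refine ⟨fun n _ => ⟨GroverWalk.exhibitsTransfer_iff_mem n,
    (GroverWalk.exhibitsTransfer_iff_mem n).trans
      (GroverWalk.mem_iff_exists_two_pow_mul_three_pow n)⟩, ?_⟩
  rintro u v ⟨τ, hτ⟩
  obtain ⟨huv, h2, -⟩ := GroverWalk.transferAt_iff_forall_nat.mp hτ
  refine ⟨GroverWalk.transferAt_iff_forall_nat.mpr ⟨huv, h2, GroverWalk.alternatesAt_twenty⟩,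
    fun σ hσ => ?_⟩
  exact GroverWalk.ten_le_of_alternatesAt_twenty
    (GroverWalk.transferAt_iff_forall_nat.mp hσ).2.2
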